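/- Let $X$ be a set. A family $\mathcal F\subseteq 2^X$ is called $t$-separable if there is a $t$-element subset $T\subseteq X$ such that for every ordered pair $(x,y)$ of distinct elements of $T$ there exists $F\in\mathcal F$ with $F\cap\{x,y\}=\{x\}$. For integers $n\ge t\ge 2$, let $s(n,t)$ denote the smallest number $s$ such that every family of at least $s$ subsets of an $n$-element set is $t$-separable. Then: (i) for every $n\ge 2$, $s(n,2)=n+2$; (ii) for every $n\ge 3$, $s(n,3)=\lfloor n^2/4\rfloor+n+2$; (iii) for $t=4$ and $t=5$, $s(n,t)=\left(\frac{n}{t-1}\right)^{t-1}+\Theta(n^{t-2})$, that is, there are constants $c,C>0$ depending only on $t$ such that for every $n\ge t$ $$\left(\frac{n}{t-1}\right)^{t-1}+c\,n^{t-2}\le s(n,t)\le\left(\frac{n}{t-1}\right)^{t-1}+C\,n^{t-2};$$ (iv) for all $n\ge t\ge 6$, $\left(\frac{n}{t-1}\right)^{t-1}<s(n,t)\le 1+\sum_{i=0}^{t-1}\binom{n}{i}$. -/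

import Mathlib

/-- A family `F` of subsets of `X` is `t`-separable if there is a `t`-element set `T ⊆ X` such that
for every ordered pair of distinct elements `x, y` of `T` some member `A` of `F` satisfies
`A ∩ {x, y} = {x}`. -/
def IsSeparableFamily {X : Type*} [DecidableEq X] (t : ℕ) (F : Finset (Finset X)) : Prop :=
  ∃ T : Finset X, T.card = t ∧
    ∀ x ∈ T, ∀ y ∈ T, x ≠ y → ∃ A ∈ F, A ∩ {x, y} = {x}

/-- The numbers `s` such that every family of at least `s` subsets of an `n`-element set is
`t`-separable. -/
def separabilityBounds (n t : ℕ) : Set ℕ :=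
  {s | ∀ F : Finset (Finset (Fin n)), s ≤ F.card → IsSeparableFamily t F}

/-- The threshold `s(n, t)`: the smallest `s` such that every family of at least `s` subsets of an
`n`-element set is `t`-separable. -/
noncomputable def sepThreshold (n t : ℕ) : ℕ :=
  sInf (separabilityBounds n t)

/-- The minimum in the definition of `s(n, t)` is attained. -/
theorem isLeast_sepThreshold (n t : ℕ) :
    IsLeast (separabilityBounds n t) (sepThreshold n t) := by
  have hne : (separabilityBounds n t).Nonempty := by
    refine ⟨Fintype.card (Finset (Fin n)) + 1, fun F hF => ?_⟩
    have := F.card_le_univ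
    omega
  exact ⟨Nat.sInf_mem hne, fun s hs => Nat.sInf_le hs⟩

/-! Preorder the ground set by `x ≤ y` when every member of `F` containing `x` contains `y`. A set
witnesses separability exactly when it is an antichain. If `F` is not `(k + 1)`-separable, Dilworth
splits the ground set into `k` chains of sizes `a i`; members of `F` are up-sets, so their trace
sizes on the chains determine them and `F.card ≤ ∏ (a i + 1)`. Conversely, the unions of initial
segments of `k` disjoint chains attain this product. Hence `s(n, k + 1) - 1` is the maximum of `∏ (a
i + 1)` over `∑ a i = n`, and (i)–(iii) and the lower bound in (iv) are estimates of it. The upper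
bound in (iv) is Sauer–Shelah. -/

/-! ### Dilworth's theorem for preorders -/

/-- **Dilworth's theorem** for a reflexive transitive relation on a finite set. -/
theorem exists_chain_coloring_of_antichain_card_le {α : Type*} [DecidableEq α] (r : α → α → Prop)
    (hrefl : ∀ x, r x x) (htrans : ∀ x y z, r x y → r y z → r x z) :
    ∀ (m : ℕ) (S : Finset α) (k : ℕ), S.card = m →
      (∀ A ⊆ S, (∀ x ∈ A, ∀ y ∈ A, x ≠ y → ¬ r x y) → A.card ≤ k) →
      ∃ f : α → ℕ, (∀ x ∈ S, f x < k) ∧ ∀ x ∈ S, ∀ y ∈ S, f x = f y → r x y ∨ r y x := by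
  intro m
  induction m using Nat.strong_induction_on with
  | _ m ih =>
  intro S k hm hS
  rcases S.eq_empty_or_nonempty with rfl | hne
  · exact ⟨fun _ => 0, by simp, by simp⟩
  -- An element with fewest elements above it is maximal up to equivalence.
  obtain ⟨a, haS, hamax⟩ : ∃ a ∈ S, ∀ b ∈ S, r a b → r b a := by
    obtain ⟨a, haS, ha⟩ := S.exists_min_image
      (fun x => (letI := Classical.decRel r; S.filter (r x)).card) hne
    refine ⟨a, haS, fun b hb hab => ?_⟩
    classical
    have h1 := ha b hb
    have hsub : S.filter (r b) ⊆ S.filter (r a) := fun z hz => by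
      simp only [Finset.mem_filter] at hz ⊢
      exact ⟨hz.1, htrans _ _ _ hab hz.2⟩
    have heq : S.filter (r b) = S.filter (r a) :=
      Finset.eq_of_subset_of_card_le hsub (by convert h1)
    have : a ∈ S.filter (r b) := heq ▸ Finset.mem_filter.2 ⟨haS, hrefl a⟩
    exact (Finset.mem_filter.1 this).2
  have hk : 0 < k := by
    have := hS {a} (by simpa using haS) (by simp)
    rw [Finset.card_singleton] at this
    omega
  have hcard : (S.erase a).card < m := by rw [← hm]; exact Finset.card_erase_lt_of_mem haS
  by_cases hA : ∀ A ⊆ S.erase a, (∀ x ∈ A, ∀ y ∈ A, x ≠ y → ¬ r x y) → A.card ≤ k - 1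
  · obtain ⟨f, hf, hf'⟩ := ih _ hcard (S.erase a) (k - 1) rfl hA
    refine ⟨fun x => if x = a then k - 1 else f x, fun x hx => ?_, fun x hx y hy hxy => ?_⟩
    · dsimp only
      split_ifs with h
      · omega
      · have := hf x (Finset.mem_erase.2 ⟨h, hx⟩)
        omega
    · dsimp only at hxy
      split_ifs at hxy with h1 h2 h2
      · subst h1 h2; exact Or.inl (hrefl _)
      · have := hf y (Finset.mem_erase.2 ⟨h2, hy⟩); omega
      · have := hf x (Finset.mem_erase.2 ⟨h1, hx⟩); omega
      · exact hf' x (Finset.mem_erase.2 ⟨h1, hx⟩) y (Finset.mem_erase.2 ⟨h2, hy⟩) hxy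
  push Not at hA
  obtain ⟨A₀, hA₀S, hA₀, hA₀k⟩ := hA
  obtain ⟨f, hf, hf'⟩ := ih _ hcard (S.erase a) k rfl
    (fun A hA h => hS A (hA.trans (Finset.erase_subset _ _)) h)
  -- an antichain of size `k` meets every colour class
  have hmeet : ∀ A ⊆ S.erase a, (∀ x ∈ A, ∀ y ∈ A, x ≠ y → ¬ r x y) → k ≤ A.card →
      ∀ i < k, ∃ x ∈ A, f x = i := by
    intro A hAS hA hAk i hi
    have hinj : Set.InjOn f A := by
      intro x hx y hy hxy
      by_contra hne
      rcases hf' x (hAS hx) y (hAS hy) hxy with h | h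
      · exact hA x hx y hy hne h
      · exact hA y hy x hx (Ne.symm hne) h
    have himg : A.image f = Finset.range k := by
      apply Finset.eq_of_subset_of_card_le
      · intro j hj
        obtain ⟨x, hx, rfl⟩ := Finset.mem_image.1 hj
        exact Finset.mem_range.2 (hf x (hAS hx))
      · rw [Finset.card_image_of_injOn hinj]; simpa using hAk
    have : i ∈ A.image f := himg ▸ Finset.mem_range.2 hi
    simpa using this
  -- `P` marks the elements lying on an antichain of full size `k`; `g i` will be a greatest such
  -- element of colour `i`.
  let P : α → Prop := fun x => ∃ A ⊆ S.erase a, (∀ x ∈ A, ∀ y ∈ A, x ≠ y → ¬ r x y) ∧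
    k ≤ A.card ∧ x ∈ A
  have htop : ∀ i < k, ∃ x ∈ S.erase a, P x ∧ f x = i ∧
      ∀ y ∈ S.erase a, P y → f y = i → r y x := by
    intro i hi
    classical
    obtain ⟨x₀, hx₀, hx₀i⟩ := hmeet A₀ hA₀S hA₀ (by omega) i hi
    let W := (S.erase a).filter (fun x => P x ∧ f x = i)
    have hW : W.Nonempty := ⟨x₀, Finset.mem_filter.2
      ⟨hA₀S hx₀, ⟨A₀, hA₀S, hA₀, by omega, hx₀⟩, hx₀i⟩⟩
    obtain ⟨x, hxW, hx⟩ := W.exists_max_image (fun x => (W.filter (fun z => r z x)).card) hW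
    obtain ⟨hxS, hxP, hxi⟩ := Finset.mem_filter.1 hxW
    refine ⟨x, hxS, hxP, hxi, fun y hyS hyP hyi => ?_⟩
    have hyW : y ∈ W := Finset.mem_filter.2 ⟨hyS, hyP, hyi⟩
    rcases hf' x hxS y hyS (hxi.trans hyi.symm) with h | h
    · have hsub : W.filter (fun z => r z x) ⊆ W.filter (fun z => r z y) := fun z hz => by
        simp only [Finset.mem_filter] at hz ⊢
        exact ⟨hz.1, htrans _ _ _ hz.2 h⟩
      have heq := Finset.eq_of_subset_of_card_le hsub (hx y hyW)
      have : y ∈ W.filter (fun z => r z x) := heq ▸ Finset.mem_filter.2 ⟨hyW, hrefl y⟩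
      exact (Finset.mem_filter.1 this).2
    · exact h
  have : Nonempty α := ⟨a⟩
  choose! g hgS hgP hgi hgmax using htop
  have hginj : Set.InjOn g (Finset.range k) := by
    intro i hi j hj hij
    have hi' := Finset.mem_range.1 hi
    have hj' := Finset.mem_range.1 hj
    rw [← hgi i hi', ← hgi j hj', hij]
  have hganti : ∀ i < k, ∀ j < k, i ≠ j → ¬ r (g i) (g j) := by
    intro i hi j hj hij hr
    obtain ⟨A, hAS, hA, hAk, hgA⟩ := hgP j hj
    obtain ⟨y, hyA, hyi⟩ := hmeet A hAS hA hAk i hi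
    refine hA y hyA _ hgA ?_ (htrans _ _ _ (hgmax i hi y (hAS hyA) ⟨A, hAS, hA, hAk, hyA⟩ hyi) hr)
    rintro rfl
    exact hij (hyi.symm.trans (hgi j hj))
  -- Otherwise `a` and all the `g i` would form an antichain of size `k + 1`.
  obtain ⟨i, hi, hgia⟩ : ∃ i < k, r (g i) a := by
    by_contra! hcon
    have hcon' : ∀ i < k, ¬ r a (g i) := fun i hi h =>
      hcon i hi (hamax _ (Finset.mem_of_mem_erase (hgS i hi)) h)
    have hnot : a ∉ (Finset.range k).image g := by
      intro h
      obtain ⟨i, hi, h⟩ := Finset.mem_image.1 h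
      exact Finset.ne_of_mem_erase (hgS i (Finset.mem_range.1 hi)) h
    have := hS (insert a ((Finset.range k).image g)) ?_ ?_
    · rw [Finset.card_insert_of_notMem hnot, Finset.card_image_of_injOn hginj,
        Finset.card_range] at this
      omega
    · intro z hz
      rcases Finset.mem_insert.1 hz with rfl | hz
      · exact haS
      · obtain ⟨i, hi, rfl⟩ := Finset.mem_image.1 hz
        exact Finset.mem_of_mem_erase (hgS i (Finset.mem_range.1 hi))
    · intro x hx y hy hxy
      rcases Finset.mem_insert.1 hx with rfl | hx' <;>
        rcases Finset.mem_insert.1 hy with rfl | hy'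
      · exact absurd rfl hxy
      · obtain ⟨j, hj, rfl⟩ := Finset.mem_image.1 hy'
        exact hcon' j (Finset.mem_range.1 hj)
      · obtain ⟨j, hj, rfl⟩ := Finset.mem_image.1 hx'
        exact hcon j (Finset.mem_range.1 hj)
      · obtain ⟨i, hi, rfl⟩ := Finset.mem_image.1 hx'
        obtain ⟨j, hj, rfl⟩ := Finset.mem_image.1 hy'
        exact hganti i (Finset.mem_range.1 hi) j (Finset.mem_range.1 hj)
          (fun h => hxy (congrArg g h))
  -- `K` is a chain with top `a`. Every `k`-antichain avoiding `a` meets colour `i` at or below `g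
  -- i`, hence meets `K`, so removing `K` lowers the width.
  classical
  let K := S.filter (fun z => z = a ∨ (f z = i ∧ r z (g i)))
  have hmemK : ∀ x ∈ S, x ∉ K → x ∈ S.erase a := fun x hx hxK =>
    Finset.mem_erase.2 ⟨fun h => hxK (Finset.mem_filter.2 ⟨hx, Or.inl h⟩), hx⟩
  have haK : a ∈ K := Finset.mem_filter.2 ⟨haS, Or.inl rfl⟩
  have hKcard : (S \ K).card < m := by
    rw [← hm]
    exact Finset.card_lt_card ⟨Finset.sdiff_subset,
      fun h => (Finset.mem_sdiff.1 (h haS)).2 haK⟩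
  obtain ⟨f₁, hf₁, hf₁'⟩ := ih _ hKcard (S \ K) (k - 1) rfl (by
    intro A hAS hA
    by_contra! hcon
    have hAS' : A ⊆ S.erase a := fun x hx =>
      hmemK x (Finset.mem_sdiff.1 (hAS hx)).1 (Finset.mem_sdiff.1 (hAS hx)).2
    obtain ⟨z, hzA, hzi⟩ := hmeet A hAS' hA (by omega) i hi
    refine (Finset.mem_sdiff.1 (hAS hzA)).2 (Finset.mem_filter.2
      ⟨(Finset.mem_sdiff.1 (hAS hzA)).1, Or.inr ⟨hzi, ?_⟩⟩)
    exact hgmax i hi z (hAS' hzA) ⟨A, hAS', hA, by omega, hzA⟩ hzi)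
  refine ⟨fun x => if x ∈ K then k - 1 else f₁ x, fun x hx => ?_, fun x hx y hy hxy => ?_⟩
  · dsimp only
    split_ifs with h
    · omega
    · have := hf₁ x (Finset.mem_sdiff.2 ⟨hx, h⟩)
      omega
  · dsimp only at hxy
    split_ifs at hxy with h1 h2 h2
    · rcases (Finset.mem_filter.1 h1).2 with rfl | ⟨hx1, hx2⟩ <;>
        rcases (Finset.mem_filter.1 h2).2 with rfl | ⟨hy1, hy2⟩
      · exact Or.inl (hrefl _)
      · exact Or.inr (htrans _ _ _ hy2 hgia)
      · exact Or.inl (htrans _ _ _ hx2 hgia)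
      · by_cases hxa : x = a
        · subst hxa; exact Or.inr (htrans _ _ _ hy2 hgia)
        by_cases hya : y = a
        · subst hya; exact Or.inl (htrans _ _ _ hx2 hgia)
        exact hf' x (Finset.mem_erase.2 ⟨hxa, hx⟩) y (Finset.mem_erase.2 ⟨hya, hy⟩)
          (hx1.trans hy1.symm)
    · have := hf₁ y (Finset.mem_sdiff.2 ⟨hy, h2⟩); omega
    · have := hf₁ x (Finset.mem_sdiff.2 ⟨hx, h1⟩); omega
    · exact hf₁' x (Finset.mem_sdiff.2 ⟨hx, h1⟩) y (Finset.mem_sdiff.2 ⟨hy, h2⟩) hxy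

/-! ### Reduction to maximizing a product -/

theorem inter_pair_eq_singleton_iff {α : Type*} [DecidableEq α] {A : Finset α} {x y : α}
    (hxy : x ≠ y) : A ∩ {x, y} = {x} ↔ x ∈ A ∧ y ∉ A := by
  constructor
  · intro h
    refine ⟨?_, fun hy => hxy ?_⟩
    · have : x ∈ A ∩ {x, y} := by rw [h]; simp
      exact (Finset.mem_inter.1 this).1
    · have : y ∈ A ∩ {x, y} := by simp [hy]
      rw [h] at this
      exact (Finset.mem_singleton.1 this).symm
  · rintro ⟨hx, hy⟩
    ext z
    simp only [Finset.mem_inter, Finset.mem_insert, Finset.mem_singleton]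
    constructor
    · rintro ⟨hz, rfl | rfl⟩
      · rfl
      · exact absurd hz hy
    · rintro rfl
      exact ⟨hx, Or.inl rfl⟩

theorem exists_card_le_prod_of_not_isSeparableFamily {n k : ℕ} {F : Finset (Finset (Fin n))}
    (hF : ¬ IsSeparableFamily (k + 1) F) :
    ∃ a : Fin k → ℕ, ∑ i, a i = n ∧ F.card ≤ ∏ i, (a i + 1) := by
  obtain ⟨f, hf, hf'⟩ := exists_chain_coloring_of_antichain_card_le
    (fun x y : Fin n => ∀ A ∈ F, x ∈ A → y ∈ A) (fun _ _ _ h => h)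
    (fun _ _ _ h1 h2 A hA h => h2 A hA (h1 A hA h)) _ Finset.univ k rfl (by
      intro A _ hA
      by_contra! hcon
      obtain ⟨T, hTA, hT⟩ := Finset.exists_subset_card_eq (Nat.succ_le_of_lt hcon)
      refine hF ⟨T, hT, fun x hx y hy hxy => ?_⟩
      have := hA x (hTA hx) y (hTA hy) hxy
      push Not at this
      obtain ⟨B, hB, hBx, hBy⟩ := this
      exact ⟨B, hB, (inter_pair_eq_singleton_iff hxy).2 ⟨hBx, hBy⟩⟩)
  refine ⟨fun i => (Finset.univ.filter (fun x => f x = i)).card, ?_, ?_⟩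
  · have := Finset.card_eq_sum_card_fiberwise (s := (Finset.univ : Finset (Fin n)))
      (t := (Finset.univ : Finset (Fin k))) (f := fun x => ⟨f x, hf x (Finset.mem_univ x)⟩)
      (fun _ _ => Finset.mem_coe.2 (Finset.mem_univ _))
    simpa [Fin.ext_iff] using this.symm
  · let φ : Finset (Fin n) → Fin k → ℕ := fun A i => (A.filter (fun x => f x = i)).card
    have hmaps : ∀ A ∈ F, φ A ∈ Fintype.piFinset (fun i : Fin k =>
        Finset.range ((Finset.univ.filter (fun x => f x = i)).card + 1)) := by
      intro A _
      rw [Fintype.mem_piFinset]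
      intro i
      exact Finset.mem_range_succ_iff.2
        (Finset.card_le_card (Finset.filter_subset_filter _ (Finset.subset_univ A)))
    have hinj : Set.InjOn φ F := by
      have key : ∀ A ∈ F, ∀ B ∈ F, φ A = φ B → A ⊆ B := by
        intro A hA B hB hAB x hx
        by_contra hxB
        have hc := congrFun hAB ⟨f x, hf x (Finset.mem_univ x)⟩
        -- Traces of members on a chain are nested, so equal sizes force equal traces.
        have hsub : B.filter (fun y => f y = f x) ⊆ A.filter (fun y => f y = f x) := by
          intro y hy
          obtain ⟨hyB, hyx⟩ := Finset.mem_filter.1 hy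
          refine Finset.mem_filter.2 ⟨?_, hyx⟩
          rcases hf' x (Finset.mem_univ x) y (Finset.mem_univ y) hyx.symm with h | h
          · exact h A hA hx
          · exact absurd (h B hB hyB) hxB
        have heq := Finset.eq_of_subset_of_card_le hsub hc.le
        have : x ∈ B.filter (fun y => f y = f x) := heq ▸ Finset.mem_filter.2 ⟨hx, rfl⟩
        exact hxB (Finset.mem_filter.1 this).1
      intro A hA B hB hAB
      exact Finset.Subset.antisymm (key A hA B hB hAB) (key B hB A hA hAB.symm)
    have := Finset.card_le_card_of_injOn φ hmaps hinj
    simpa [Fintype.card_piFinset] using this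

theorem sepThreshold_le_of_prod_le {n k M : ℕ}
    (h : ∀ a : Fin k → ℕ, ∑ i, a i = n → ∏ i, (a i + 1) ≤ M) :
    sepThreshold n (k + 1) ≤ M + 1 := by
  refine (isLeast_sepThreshold n (k + 1)).2 fun F hF => ?_
  by_contra hcon
  obtain ⟨a, ha, hFa⟩ := exists_card_le_prod_of_not_isSeparableFamily hcon
  have := h a ha
  omega

theorem prod_lt_sepThreshold {n k : ℕ} (a : Fin k → ℕ) (ha : ∑ i, a i = n) :
    ∏ i, (a i + 1) < sepThreshold n (k + 1) := by
  by_contra! hcon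
  have e : Fin n ≃ Σ i, Fin (a i) := Fintype.equivOfCardEq (by simp [ha])
  -- `φ b` takes the first `b i` elements of each chain `i`. Two points of one chain cannot be
  -- separated in both directions, and `k + 1` points put two on one chain.
  let φ : (∀ i, Fin (a i + 1)) → Finset (Fin n) := fun b =>
    Finset.univ.filter (fun x => ((e x).2 : ℕ) < b (e x).1)
  have hinj : Function.Injective φ := by
    have key : ∀ b c, φ b = φ c → ∀ i, (b i : ℕ) ≤ c i := by
      intro b c hbc i
      by_contra! hlt
      have hci : (c i : ℕ) < a i := by have := (b i).isLt; omega
      have hmem : ∀ d, e.symm ⟨i, ⟨c i, hci⟩⟩ ∈ φ d ↔ (c i : ℕ) < d i := fun d => by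
        rw [Finset.mem_filter_univ, Equiv.apply_symm_apply]
      exact lt_irrefl _ ((hmem c).1 (hbc ▸ (hmem b).2 hlt))
    intro b c hbc
    ext i
    exact le_antisymm (key b c hbc i) (key c b hbc.symm i)
  obtain ⟨T, hT, hsep⟩ := (isLeast_sepThreshold n (k + 1)).1 (Finset.univ.image φ) (by
    rw [Finset.card_image_of_injective _ hinj]
    simpa using hcon)
  obtain ⟨x, hx, y, hy, hxy, hfib⟩ := Finset.exists_ne_map_eq_of_card_lt_of_maps_to
    (s := T) (t := (Finset.univ : Finset (Fin k))) (f := fun x => (e x).1)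
    (by simp [hT]) (fun _ _ => Finset.mem_coe.2 (Finset.mem_univ _))
  have key : ∀ x ∈ T, ∀ y ∈ T, x ≠ y → (e x).1 = (e y).1 → ¬ ((e y).2 : ℕ) ≤ (e x).2 := by
    intro x hx y hy hxy hfib hle
    obtain ⟨A, hA, hAxy⟩ := hsep x hx y hy hxy
    obtain ⟨b, -, rfl⟩ := Finset.mem_image.1 hA
    obtain ⟨h1, h2⟩ := (inter_pair_eq_singleton_iff hxy).1 hAxy
    refine h2 (Finset.mem_filter.2 ⟨Finset.mem_univ _, ?_⟩)
    have hb : (b (e y).1 : ℕ) = b (e x).1 := by rw [hfib]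
    rw [hb]
    exact hle.trans_lt (Finset.mem_filter.1 h1).2
  rcases le_total ((e y).2 : ℕ) (e x).2 with h | h
  · exact key x hx y hy hxy hfib h
  · exact key y hy x hx hxy.symm hfib.symm h

/-! ### Asymptotic estimates -/

/-- A balanced partition has parts of size at least `n / k` rounded down, and one more than that is
at least `(n + 1) / k`. The surplus `1 / k` yields the second-order term. -/
theorem add_inv_pow_lt_sepThreshold {k : ℕ} (hk : 0 < k) (n : ℕ) :
    (((n : ℝ) + 1) / k) ^ k < sepThreshold n (k + 1) := by
  let a : Fin k → ℕ := fun i => n / k + if (i : ℕ) < n % k then 1 else 0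
  have ha : ∑ i, a i = n := by
    have hr : n % k ≤ k := (Nat.mod_lt n hk).le
    have : ∑ i : Fin k, (if (i : ℕ) < n % k then 1 else 0) = n % k := by
      rw [Fin.sum_univ_eq_sum_range (fun i => if i < n % k then 1 else 0) k,
        Finset.sum_boole]
      have : (Finset.range k).filter (fun i => i < n % k) = Finset.range (n % k) := by
        ext i; simp only [Finset.mem_filter, Finset.mem_range]; omega
      simp [this]
    simp only [a, Finset.sum_add_distrib, this]
    simpa using Nat.div_add_mod n k
  refine lt_of_le_of_lt ?_ (Nat.cast_lt.2 (prod_lt_sepThreshold a ha))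
  push_cast
  have hconst : (((n : ℝ) + 1) / k) ^ k = ∏ _i : Fin k, ((n : ℝ) + 1) / k := by
    rw [Finset.prod_const, Finset.card_univ, Fintype.card_fin]
  rw [hconst]
  refine Finset.prod_le_prod (fun i _ => by positivity) fun i _ => ?_
  have hn : n + 1 ≤ k * (a i + 1) := by
    have h1 := Nat.div_add_mod n k
    have h2 := Nat.mod_lt n hk
    have h3 : k * (n / k + 1) ≤ k * (a i + 1) :=
      Nat.mul_le_mul_left k (by simp only [a]; omega)
    rw [mul_add] at h3
    omega
  rw [div_le_iff₀ (by exact_mod_cast hk), mul_comm]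
  exact_mod_cast hn

theorem pow_add_pow_lt_sepThreshold {k : ℕ} (hk : 0 < k) (n : ℕ) :
    ((n : ℝ) / k) ^ k + ((n : ℝ) / k) ^ (k - 1) < sepThreshold n (k + 1) := by
  refine lt_of_le_of_lt ?_ (add_inv_pow_lt_sepThreshold hk n)
  have hk' : (k : ℝ) ≠ 0 := by exact_mod_cast hk.ne'
  have h := pow_add_mul_le_add_pow (R := ℝ) (a := (n : ℝ) / k) (b := 1 / k) (by positivity)
    (by positivity) k
  rw [← add_div] at h
  refine le_trans (le_of_eq ?_) h
  field_simp

/-- The product of `a i + 1` over `k` indices, given `∑ a i`, is largest when all are equal. -/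
theorem prod_add_one_le_div_add_one_pow {n k : ℕ} (hk : 0 < k) (a : Fin k → ℕ)
    (ha : ∑ i, a i = n) : ((∏ i, (a i + 1) : ℕ) : ℝ) ≤ ((n : ℝ) / k + 1) ^ k := by
  have hk' : (0 : ℝ) < k := by exact_mod_cast hk
  have h := Real.geom_mean_le_arith_mean Finset.univ (fun _ : Fin k => (1 : ℝ))
    (fun i => (a i : ℝ) + 1) (fun _ _ => zero_le_one) (by simpa using hk)
    (fun _ _ => by positivity)
  have hsum : ∑ i, ((a i : ℝ) + 1) = n + k := by
    rw [Finset.sum_add_distrib, ← Nat.cast_sum, ha]; simp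
  simp only [Real.rpow_one, one_mul, hsum, Finset.sum_const, Finset.card_univ, Fintype.card_fin,
    nsmul_eq_mul, mul_one] at h
  have h2 := pow_le_pow_left₀ (by positivity) h k
  rw [Real.rpow_inv_natCast_pow (by positivity) hk.ne', add_div, div_self hk'.ne'] at h2
  exact_mod_cast h2

theorem sepThreshold_le_div_add_one_pow {k : ℕ} (hk : 0 < k) (n : ℕ) :
    (sepThreshold n (k + 1) : ℝ) ≤ ((n : ℝ) / k + 1) ^ k + 1 := by
  have h := sepThreshold_le_of_prod_le (n := n) (k := k) (M := ⌊((n : ℝ) / k + 1) ^ k⌋₊)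
    (fun a ha => Nat.le_floor (prod_add_one_le_div_add_one_pow hk a ha))
  have h2 := Nat.floor_le (a := ((n : ℝ) / k + 1) ^ k) (by positivity)
  have h3 : (sepThreshold n (k + 1) : ℝ) ≤ (⌊((n : ℝ) / k + 1) ^ k⌋₊ : ℝ) + 1 := by
    exact_mod_cast h
  linarith

/-- The non-leading binomial coefficients sum to `2 ^ (m + 1) - 1`, and `x ≥ 1` bounds each lower
power by `x ^ m`. -/
theorem add_one_pow_le_pow_add {x : ℝ} (hx : 1 ≤ x) (m : ℕ) :
    (x + 1) ^ (m + 1) ≤ x ^ (m + 1) + (2 ^ (m + 1) - 1) * x ^ m := by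
  induction m with
  | zero => norm_num
  | succ m ih =>
    have h1 := mul_le_mul_of_nonneg_right ih (by linarith : 0 ≤ x + 1)
    have h2 : x ^ m ≤ x ^ (m + 1) := pow_le_pow_right₀ hx (Nat.le_succ m)
    have h3 : (0 : ℝ) ≤ 2 ^ (m + 1) - 1 := sub_nonneg.2 (one_le_pow₀ one_le_two)
    have h4 := mul_le_mul_of_nonneg_left h2 h3
    calc (x + 1) ^ (m + 1 + 1) ≤ (x ^ (m + 1) + (2 ^ (m + 1) - 1) * x ^ m) * (x + 1) := by
          rwa [pow_succ (x + 1)]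
      _ = x ^ (m + 2) + (x ^ (m + 1) + (2 ^ (m + 1) - 1) * x ^ (m + 1)
            + (2 ^ (m + 1) - 1) * x ^ m) := by ring
      _ ≤ x ^ (m + 2) + (x ^ (m + 1) + (2 ^ (m + 1) - 1) * x ^ (m + 1)
            + (2 ^ (m + 1) - 1) * x ^ (m + 1)) := by gcongr
      _ = _ := by ring

theorem sepThreshold_le_pow_add_mul_pow {n k : ℕ} (hk : 0 < k) (hn : k ≤ n) :
    (sepThreshold n (k + 1) : ℝ) ≤ ((n : ℝ) / k) ^ k + 2 ^ k * (n : ℝ) ^ (k - 1) := by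
  obtain ⟨m, rfl⟩ : ∃ m, k = m + 1 := ⟨k - 1, by omega⟩
  have h := sepThreshold_le_div_add_one_pow hk n
  have hk1 : (1 : ℝ) ≤ (m + 1 : ℕ) := by exact_mod_cast hk
  have hx : 1 ≤ (n : ℝ) / (m + 1 : ℕ) := by
    rw [le_div_iff₀ (by linarith), one_mul]
    exact_mod_cast hn
  have h2 := add_one_pow_le_pow_add hx m
  -- This absorbs the additive `1`, turning `2 ^ k - 1` into `2 ^ k`.
  have h3 : 1 ≤ ((n : ℝ) / (m + 1 : ℕ)) ^ m := one_le_pow₀ hx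
  have h4 : ((n : ℝ) / (m + 1 : ℕ)) ^ m ≤ (n : ℝ) ^ m :=
    pow_le_pow_left₀ (by positivity) (div_le_self (by positivity) hk1) m
  have h5 := mul_le_mul_of_nonneg_left h4 (by positivity : (0 : ℝ) ≤ 2 ^ (m + 1))
  rw [Nat.add_sub_cancel]
  linarith

/-! ### The Sauer–Shelah bound -/

/-- A shattered `t`-set is separated, since each of its singletons is a trace of some member. -/
theorem sepThreshold_le_one_add_sum_choose (n t : ℕ) :
    sepThreshold n t ≤ 1 + ∑ i ∈ Finset.range t, n.choose i := by
  refine (isLeast_sepThreshold n t).2 fun F hF => ?_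
  have hdim : t ≤ F.vcDim := by
    by_contra! hlt
    have h1 := F.card_le_card_shatterer.trans F.card_shatterer_le_sum_vcDim
    have h2 : ∑ i ∈ Finset.Iic F.vcDim, (Fintype.card (Fin n)).choose i ≤
        ∑ i ∈ Finset.range t, n.choose i := by
      rw [Fintype.card_fin]
      exact Finset.sum_le_sum_of_subset fun i hi =>
        Finset.mem_range.2 ((Finset.mem_Iic.1 hi).trans_lt hlt)
    omega
  have hne : F.shatterer.Nonempty := by
    have : F.Nonempty := Finset.card_pos.1 (by omega)
    exact ⟨∅, Finset.mem_shatterer.2 (Finset.shatters_empty.2 this)⟩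
  obtain ⟨S, hS, hSc⟩ := F.shatterer.exists_mem_eq_sup hne Finset.card
  obtain ⟨T, hTS, hT⟩ := Finset.exists_subset_card_eq (hdim.trans_eq hSc)
  have hsh := (Finset.mem_shatterer.1 hS).mono_right hTS
  refine ⟨T, hT, fun x hx y hy hxy => ?_⟩
  obtain ⟨A, hA, hAx⟩ := hsh.exists_inter_eq_singleton hx
  refine ⟨A, hA, (inter_pair_eq_singleton_iff hxy).2 ⟨?_, fun hyA => hxy ?_⟩⟩
  · exact (Finset.mem_inter.1 (hAx ▸ Finset.mem_singleton_self x)).2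
  · exact (Finset.mem_singleton.1 (hAx ▸ Finset.mem_inter.2 ⟨hy, hyA⟩)).symm

/-! ### Exact values and the final assembly -/

theorem sepThreshold_two (n : ℕ) : sepThreshold n 2 = n + 2 := by
  refine le_antisymm (sepThreshold_le_of_prod_le (k := 1) (M := n + 1) fun a ha => ?_)
    (Nat.succ_le_of_lt ?_)
  · simp at ha ⊢
    omega
  · simpa using prod_lt_sepThreshold (k := 1) (fun _ => n) (by simp)

theorem sepThreshold_three (n : ℕ) : sepThreshold n 3 = n ^ 2 / 4 + n + 2 := by
  refine le_antisymm (sepThreshold_le_of_prod_le (k := 2) (M := n ^ 2 / 4 + n + 1) fun a ha => ?_)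
    (Nat.succ_le_of_lt ?_)
  · simp only [Fin.sum_univ_two, Fin.prod_univ_two] at ha ⊢
    have : a 0 * a 1 ≤ n ^ 2 / 4 := by
      rw [Nat.le_div_iff_mul_le (by norm_num), ← ha]
      zify
      nlinarith [sq_nonneg ((a 0 : ℤ) - a 1)]
    linarith
  · have h := prod_lt_sepThreshold (n := n) (k := 2) ![n / 2, n - n / 2] (by
      simp only [Fin.sum_univ_two, Matrix.cons_val_zero, Matrix.cons_val_one]; omega)
    refine lt_of_le_of_lt (le_of_eq ?_) h
    simp only [Fin.prod_univ_two, Matrix.cons_val_zero, Matrix.cons_val_one]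
    rcases Nat.even_or_odd' n with ⟨m, rfl | rfl⟩
    · have h1 : (2 * m) ^ 2 / 4 = m * m := by
        rw [show (2 * m) ^ 2 = 4 * (m * m) by ring]; omega
      have h2 : 2 * m / 2 = m := by omega
      rw [h1, h2, show 2 * m - m = m by omega]
      ring
    · have h1 : (2 * m + 1) ^ 2 / 4 = m * m + m := by
        rw [show (2 * m + 1) ^ 2 = 4 * (m * m + m) + 1 by ring]; omega
      have h2 : (2 * m + 1) / 2 = m := by omega
      rw [h1, h2, show 2 * m + 1 - m = m + 1 by omega]
      ring

theorem theorem6 :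
    -- (i)
    (∀ n : ℕ, 2 ≤ n → sepThreshold n 2 = n + 2) ∧
    -- (ii), where the division of natural numbers rounds down
    (∀ n : ℕ, 3 ≤ n → sepThreshold n 3 = n ^ 2 / 4 + n + 2) ∧
    -- (iii)
    (∀ t : ℕ, t = 4 ∨ t = 5 →
      ∃ c C : ℝ, 0 < c ∧ 0 < C ∧ ∀ n : ℕ, t ≤ n →
        ((n : ℝ) / ((t : ℝ) - 1)) ^ (t - 1) + c * (n : ℝ) ^ (t - 2) ≤ (sepThreshold n t : ℝ) ∧
        (sepThreshold n t : ℝ) ≤ ((n : ℝ) / ((t : ℝ) - 1)) ^ (t - 1) + C * (n : ℝ) ^ (t - 2)) ∧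
    -- (iv)
    (∀ n t : ℕ, 6 ≤ t → t ≤ n →
      ((n : ℝ) / ((t : ℝ) - 1)) ^ (t - 1) < (sepThreshold n t : ℝ) ∧
      sepThreshold n t ≤ 1 + ∑ i ∈ Finset.range t, n.choose i) := by
  refine ⟨fun n _ => sepThreshold_two n, fun n _ => sepThreshold_three n, fun t ht => ?_,
    fun n t ht _ => ⟨?_, sepThreshold_le_one_add_sum_choose n t⟩⟩
  · obtain ⟨k, rfl⟩ : ∃ k, t = k + 1 := ⟨t - 1, by omega⟩
    have hk : 0 < k := by omega
    have hkR : (0 : ℝ) < k := by exact_mod_cast hk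
    -- The constant `c` is the coefficient of `n ^ (k - 1)` in `(n / k) ^ (k - 1)`.
    refine ⟨1 / (k : ℝ) ^ (k - 1), 2 ^ k, by positivity, by positivity, fun n hn => ?_⟩
    rw [Nat.cast_add_one, add_sub_cancel_right, Nat.add_sub_cancel,
      show k + 1 - 2 = k - 1 by omega]
    refine ⟨?_, sepThreshold_le_pow_add_mul_pow hk (by omega)⟩
    have h := (pow_add_pow_lt_sepThreshold hk n).le
    rwa [div_pow (n : ℝ) k (k - 1), div_eq_mul_one_div ((n : ℝ) ^ (k - 1)), mul_comm (_ ^ (k - 1))]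
      at h
  · obtain ⟨k, rfl⟩ : ∃ k, t = k + 1 := ⟨t - 1, by omega⟩
    rw [Nat.cast_add_one, add_sub_cancel_right, Nat.add_sub_cancel]
    refine lt_of_le_of_lt ?_ (pow_add_pow_lt_sepThreshold (by omega) n)
    exact le_add_of_nonneg_right (by positivity)
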